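/- Fix $p\in[0,1]$. For each $N$ let $\boldsymbol d=(d_i)_{i\in[N]}$ be a degree sequence with $\lfloor pN\rfloor$ vertices of degree $2$ and $N-\lfloor pN\rfloor$ vertices of degree $1$, where $N$ is restricted to those values for which $\ell_N=\sum_i d_i=N+\lfloor pN\rfloor$ is even. Let $G_N=\mathrm{CM}_N(\mathbf 1,\mathbf 2)$ be the configuration model with this degree sequence, i.e. the random multigraph on $[N]$ obtained from a uniformly random perfect matching of the $\ell_N$ half-edges ($d_i$ of them attached to vertex $i$), and let $Q_N$ be its law (and the corresponding expectation). For $\beta\ge 0$, $B\in\mathbb R$ and $\sigma\in\{-1,1\}^N$ define the annealed measure $$\widetilde P_N(\sigma)=\frac{Q_N\big(\exp[\beta\sum_{(i,j)\in E_N}\sigma_i\sigma_j+B\sum_{i\in[N]}\sigma_i]\big)}{Q_N(Z_N(\beta,B))},\qquad Z_N(\beta,B)=\sum_{\sigma\in\{-1,1\}^N}\exp\Big[\beta\sum_{(i,j)\in E_N}\sigma_i\sigma_j+B\sum_{i\in[N]}\sigma_i\Big],$$ where the edges are counted with multiplicity (a self-loop being one edge), and let $S_N=\sum_{i\in[N]}\sigma_i$.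 Then for all $\beta\ge0$ and $B\in\mathbb R$ the limits $$\widetilde\psi(\beta,B)=\lim_{N\to\infty}\frac1N\log Q_N(Z_N(\beta,B)),\qquad \widetilde M(\beta,B)=\lim_{N\to\infty}\widetilde P_N\Big(\frac{S_N}{N}\Big)$$ exist and depend only on $p,\beta,B$; $\widetilde\psi(\beta,\cdot)$ is differentiable with $\widetilde M(\beta,B)=\frac{\partial}{\partial B}\widetilde\psi(\beta,B)$; and for every $\varepsilon>0$ there is a number $L=L(\varepsilon)>0$ such that $$\widetilde P_N\Big(\Big|\frac{S_N}{N}-\widetilde M(\beta,B)\Big|\ge\varepsilon\Big)\le e^{-NL}\qquad\text{for all sufficiently large } N.$$ -/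

import Mathlib

open Filter Topology

noncomputable section

namespace AnnealedIsing

/-- The half-edges of a degree sequence `d` on the vertex set `Fin N`: `d i` of them sit at vertex `i`. -/
abbrev HalfEdge {N : ℕ} (d : Fin N → ℕ) : Type := Σ i : Fin N, Fin (d i)

/-- The pairings of the half-edges, i.e. the fixed-point-free involutions of the set of half-edges.
The half-edge `h` is joined to `π h`. Self-loops and multiple edges of the resulting multigraph
are allowed. -/
def pairings {N : ℕ} (d : Fin N → ℕ) : Finset (Equiv.Perm (HalfEdge d)) :=
  Finset.univ.filter fun π => (∀ h, π (π h) = h) ∧ ∀ h, π h ≠ h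

/-- Expectation with respect to the law of the configuration model with degree sequence `d`:
the pairing is uniform among all pairings of the half-edges. -/
def graphExpect {N : ℕ} (d : Fin N → ℕ) (X : Equiv.Perm (HalfEdge d) → ℝ) : ℝ :=
  (∑ π ∈ pairings d, X π) / (pairings d).card

/-- Spin configurations: elements of `{-1, 1}^N`. -/
abbrev Spins (N : ℕ) : Type := Fin N → ℤˣ

/-- The value of the spin at the vertex `i`, as a real number. -/
def spin {N : ℕ} (σ : Spins N) (i : Fin N) : ℝ := ((σ i : ℤ) : ℝ)

/-- The total spin. -/
def totalSpin {N : ℕ} (σ : Spins N) : ℝ := ∑ i, spin σ i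

/-- The sum of `σ_i σ_j` over the edges of the multigraph given by the pairing `π`, counted with
multiplicity (a self-loop is one edge and contributes `1`). Each edge consists of the two half-edges
`h` and `π h`, so that the sum over half-edges counts every edge exactly twice. -/
def edgeSum {N : ℕ} {d : Fin N → ℕ} (π : Equiv.Perm (HalfEdge d)) (σ : Spins N) : ℝ :=
  (∑ h : HalfEdge d, spin σ h.1 * spin σ (π h).1) / 2

/-- The Boltzmann weight of `σ` on the multigraph given by `π`. -/
def boltzmann {N : ℕ} {d : Fin N → ℕ} (β B : ℝ) (π : Equiv.Perm (HalfEdge d)) (σ : Spins N) : ℝ :=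
  Real.exp (β * edgeSum π σ + B * totalSpin σ)

/-- The partition function of the Ising model on the multigraph given by `π`. -/
def partitionFn {N : ℕ} {d : Fin N → ℕ} (β B : ℝ) (π : Equiv.Perm (HalfEdge d)) : ℝ :=
  ∑ σ : Spins N, boltzmann β B π σ

/-- The annealed measure: the mass of the configuration `σ`. -/
def annealedMass {N : ℕ} (d : Fin N → ℕ) (β B : ℝ) (σ : Spins N) : ℝ :=
  graphExpect d (fun π => boltzmann β B π σ) / graphExpect d (partitionFn β B)

/-- The annealed measure of a set of spin configurations. -/
def annealedProb {N : ℕ} (d : Fin N → ℕ) (β B : ℝ) (A : Set (Spins N)) : ℝ :=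
  ∑ σ : Spins N, A.indicator (annealedMass d β B) σ

/-- The annealed pressure in finite volume. -/
def annealedPressure {N : ℕ} (d : Fin N → ℕ) (β B : ℝ) : ℝ :=
  Real.log (graphExpect d (partitionFn β B)) / N

/-- The annealed magnetization in finite volume: the mean of `S_N / N` under the annealed measure. -/
def annealedMagnetization {N : ℕ} (d : Fin N → ℕ) (β B : ℝ) : ℝ :=
  ∑ σ : Spins N, annealedMass d β B σ * (totalSpin σ / N)

/-- Degree sequences of the configuration models `CM_N(1,2)` with parameter `p`: for every `N`,
exactly `⌊pN⌋` of the `N` vertices have degree `2` and the remaining ones have degree `1`. -/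
def IsCM12 (p : ℝ) (d : ∀ N : ℕ, Fin N → ℕ) : Prop :=
  ∀ N, (∀ i, d N i = 1 ∨ d N i = 2) ∧
    (Finset.univ.filter fun i => d N i = 2).card = ⌊p * N⌋₊

/-- `N → ∞` along the sizes for which the total degree is even, i.e. for which the configuration
model with degree sequence `d N` exists. -/
def admissible (d : ∀ N : ℕ, Fin N → ℕ) : Filter ℕ :=
  atTop ⊓ 𝓟 {N | Even (∑ i, d N i)}

end AnnealedIsing

end

namespace AnnealedIsing

open Real

/-! A Wick formula on the circle makes the average over pairings explicit. For spins s, t the edge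
weight exp (β s t) = cosh β + s t sinh β is an inner product of two plane vectors. Hence the sum
over pairings of the product of edge weights is, up to a factor depending only on ℓ_N, a circle
integral of a product of linear forms, one per half-edge (`sum_matchingWeight_eq_integral`). Under
the integral the sum over spins factorizes over the vertices, so Q_N(Z_N) is the integral of A ^ (N
- ⌊pN⌋) * D ^ ⌊pN⌋ divided by that of cos ^ ℓ_N, with A linear and D quadratic in (cos θ, sin θ)
(`graphExpect_partitionFn`).

By Laplace's method the pressure is the maximum of (1 - p) log |A| + p log D. Since log x ≤ x - 1,
maximality at θ follows once θ is a top eigenvector of the quadratic form (1 - p) A² / A(θ)² + 2p D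
/ D(θ). For β, B > 0 a critical direction in the first quadrant exists by the intermediate value
theorem, and positivity of the off-diagonal entry makes it a top eigenvector (`exists_isOptimal`).

Differentiability in B needs no control of how θ moves: the pressure at b lies between its value at
the frozen θ and a bound through the perturbed top eigenvalue, both differentiable and equal at b =
B (`differentiableAt_pressureFn`). Finally, tilting by exp (t S_N) shifts B to B + t, so exponential
Chebyshev bounds and the derivative of the pressure give concentration, hence convergence of the
mean. -/

/-- The linear form on the plane given by `w`, along the unit circle. -/
noncomputable def circleForm (w : ℝ × ℝ) (θ : ℝ) : ℝ := w.1 * cos θ + w.2 * sin θ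

/-- The standard inner product of the plane. -/
def dot (w z : ℝ × ℝ) : ℝ := w.1 * z.1 + w.2 * z.2

/-! ### Integration by parts on the circle -/

@[fun_prop]
theorem continuous_circleForm (w : ℝ × ℝ) : Continuous (circleForm w) := by
  unfold circleForm; fun_prop

theorem hasDerivAt_circleForm (w : ℝ × ℝ) (θ : ℝ) :
    HasDerivAt (circleForm w) (circleForm (w.2, -w.1) θ) θ := by
  have h := ((hasDerivAt_cos θ).const_mul w.1).add ((hasDerivAt_sin θ).const_mul w.2)
  refine h.congr_deriv ?_
  simp only [circleForm]; ring

/-- A linear form and its derivative are the coordinates of its vector in a rotated orthonormal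
frame, and the inner product is frame independent. -/
theorem circleForm_rotate_mul (w z : ℝ × ℝ) (θ : ℝ) :
    circleForm (w.2, -w.1) θ * circleForm (z.2, -z.1) θ =
      dot w z - circleForm w θ * circleForm z θ := by
  simp only [circleForm, dot]
  linear_combination (w.1 * z.1 + w.2 * z.2) * sin_sq_add_cos_sq θ

/-- The Wick recursion: the derivative of ℓ_a' ∏_{i ≠ a} ℓ_i integrates to zero over a period. The
full product appears once from ℓ_a'' = -ℓ_a and once for each j ≠ a from `circleForm_rotate_mul`,
which gives the factor `S.card`. -/
theorem card_mul_integral_prod_circleForm {α : Type*} [DecidableEq α] (S : Finset α)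
    (w : α → ℝ × ℝ) {a : α} (ha : a ∈ S) :
    (S.card : ℝ) * ∫ θ in -π..π, ∏ i ∈ S, circleForm (w i) θ =
      ∑ j ∈ S.erase a, dot (w a) (w j) *
        ∫ θ in -π..π, ∏ i ∈ (S.erase a).erase j, circleForm (w i) θ := by
  set F : ℝ → ℝ := fun θ =>
    circleForm ((w a).2, -(w a).1) θ * ∏ i ∈ S.erase a, circleForm (w i) θ with hF
  have hderiv : ∀ θ, HasDerivAt F (∑ j ∈ S.erase a, dot (w a) (w j) *
      ∏ i ∈ (S.erase a).erase j, circleForm (w i) θ -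
      (S.card : ℝ) * ∏ i ∈ S, circleForm (w i) θ) θ := by
    intro θ
    have h := (hasDerivAt_circleForm ((w a).2, -(w a).1) θ).mul
      (HasDerivAt.fun_finsetProd (u := S.erase a) (f := fun i => circleForm (w i))
        (fun i _ => hasDerivAt_circleForm (w i) θ))
    refine h.congr_deriv ?_
    have hcard : (S.card : ℝ) = (S.erase a).card + 1 := by
      rw [← Finset.card_erase_add_one ha]; push_cast; rfl
    rw [Finset.mul_sum, hcard, ← Finset.mul_prod_erase S _ ha]
    have hj : ∀ j ∈ S.erase a, circleForm ((w a).2, -(w a).1) θ *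
        ((∏ i ∈ (S.erase a).erase j, circleForm (w i) θ) • circleForm ((w j).2, -(w j).1) θ) =
        dot (w a) (w j) * (∏ i ∈ (S.erase a).erase j, circleForm (w i) θ) -
          circleForm (w a) θ * ∏ i ∈ S.erase a, circleForm (w i) θ := by
      intro j hj
      rw [← Finset.mul_prod_erase (S.erase a) _ hj, smul_eq_mul]
      linear_combination (∏ i ∈ (S.erase a).erase j, circleForm (w i) θ) *
        circleForm_rotate_mul (w a) (w j) θ
    rw [Finset.sum_congr rfl hj, Finset.sum_sub_distrib, Finset.sum_const, nsmul_eq_mul]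
    simp only [circleForm]
    ring
  have hint := intervalIntegral.integral_eq_sub_of_hasDerivAt (a := -π) (b := π)
    (fun θ _ => hderiv θ) (by apply Continuous.intervalIntegrable; fun_prop)
  have hper : F π - F (-π) = 0 := by simp [hF, circleForm]
  rw [hper, intervalIntegral.integral_sub, intervalIntegral.integral_finsetSum,
    intervalIntegral.integral_const_mul] at hint
  · simp only [intervalIntegral.integral_const_mul] at hint
    linarith
  · intro i _; apply Continuous.intervalIntegrable; fun_prop
  · apply Continuous.intervalIntegrable; fun_prop
  · apply Continuous.intervalIntegrable; fun_prop

/-! ### Perfect matchings and the Wick formula -/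

section Matchings

variable {α : Type*} [Fintype α] [DecidableEq α]

/-- The perfect matchings of `S`, as involutions of the whole type that move exactly `S`. -/
def matchings (S : Finset α) : Finset (Equiv.Perm α) :=
  Finset.univ.filter fun τ => (∀ h, τ (τ h) = h) ∧ ∀ h, τ h ≠ h ↔ h ∈ S

theorem mem_matchings {S : Finset α} {τ : Equiv.Perm α} :
    τ ∈ matchings S ↔ (∀ h, τ (τ h) = h) ∧ ∀ h, τ h ≠ h ↔ h ∈ S := by
  simp [matchings]

/-- The weight of a matching with symmetric pair interaction `f`. -/
noncomputable def matchingWeight (f : α → α → ℝ) (S : Finset α) (τ : Equiv.Perm α) : ℝ :=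
  exp ((∑ h ∈ S, f h (τ h)) / 2)

theorem swap_mul_mem_matchings_erase {S : Finset α} {τ : Equiv.Perm α} {a : α} (ha : a ∈ S)
    (hτ : τ ∈ matchings S) :
    Equiv.swap a (τ a) * τ ∈ matchings ((S.erase a).erase (τ a)) := by
  rw [mem_matchings] at hτ ⊢
  obtain ⟨hi, hs⟩ := hτ
  have key : ∀ h, (Equiv.swap a (τ a) * τ) h = if h = a ∨ h = τ a then h else τ h := by
    intro h
    rw [Equiv.Perm.mul_apply]
    split_ifs with hh
    · rcases hh with rfl | rfl
      · simp
      · simp [hi]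
    · push Not at hh
      apply Equiv.swap_apply_of_ne_of_ne
      · intro h'; apply hh.2; rw [← h', hi]
      · exact fun h' => hh.1 (τ.injective h')
  refine ⟨fun h => ?_, fun h => ?_⟩
  · rw [key h]
    split_ifs with hh
    · rw [key h, if_pos hh]
    · rw [key, if_neg, hi]
      push Not at hh ⊢
      refine ⟨fun h' => ?_, fun h' => hh.1 (τ.injective h')⟩
      apply hh.2; rw [← h', hi]
  · rw [key h]
    have := hs h
    split_ifs with hh
    · simp only [Finset.mem_erase]; tauto
    · simp only [Finset.mem_erase]; tauto

theorem swap_mul_apply {S : Finset α} {τ : Equiv.Perm α} {a j : α}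
    (hτ : τ ∈ matchings ((S.erase a).erase j)) (h : α) :
    (Equiv.swap a j * τ) h = if h = a then j else if h = j then a else τ h := by
  rw [mem_matchings] at hτ
  obtain ⟨hi, hs⟩ := hτ
  have ha : τ a = a := by
    by_contra h; simpa using (hs a).1 h
  have hj : τ j = j := by
    by_contra h; simpa using (hs j).1 h
  rw [Equiv.Perm.mul_apply]
  split_ifs with h1 h2
  · rw [h1, ha, Equiv.swap_apply_left]
  · rw [h2, hj, Equiv.swap_apply_right]
  · apply Equiv.swap_apply_of_ne_of_ne
    · exact fun h' => h1 (τ.injective (h'.trans ha.symm))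
    · exact fun h' => h2 (τ.injective (h'.trans hj.symm))

theorem swap_mul_mem_matchings {S : Finset α} {τ : Equiv.Perm α} {a j : α} (ha : a ∈ S)
    (hj : j ∈ S.erase a) (hτ : τ ∈ matchings ((S.erase a).erase j)) :
    Equiv.swap a j * τ ∈ matchings S := by
  have key := swap_mul_apply hτ
  rw [mem_matchings] at hτ ⊢
  obtain ⟨hi, hs⟩ := hτ
  obtain ⟨hja, hjS⟩ := Finset.mem_erase.1 hj
  have hpa : τ a = a := by
    by_contra h; simpa using (hs a).1 h
  have hpj : τ j = j := by
    by_contra h; simpa using (hs j).1 h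
  refine ⟨fun h => ?_, fun h => ?_⟩
  · rw [key h]
    split_ifs with h1 h2
    · rw [key, if_neg hja, if_pos rfl, h1]
    · rw [key, if_pos rfl, h2]
    · rw [key, if_neg, if_neg, hi]
      · exact fun h' => h2 (τ.injective (h'.trans hpj.symm))
      · exact fun h' => h1 (τ.injective (h'.trans hpa.symm))
  · rw [key h]
    have := hs h
    split_ifs with h1 h2
    · subst h1; tauto
    · subst h2; tauto
    · simp only [Finset.mem_erase] at this; tauto

/-- Classify matchings by the partner j of a; multiplication by the transposition of a and j removes
or restores that pair. -/
theorem sum_matchingWeight_eq (f : α → α → ℝ) (hf : ∀ x y, f x y = f y x) {S : Finset α} {a : α}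
    (ha : a ∈ S) :
    ∑ τ ∈ matchings S, matchingWeight f S τ =
      ∑ j ∈ S.erase a, exp (f a j) *
        ∑ τ ∈ matchings ((S.erase a).erase j), matchingWeight f ((S.erase a).erase j) τ := by
  simp only [Finset.mul_sum]
  rw [Finset.sum_sigma']
  refine (Finset.sum_bij' (fun x _ => Equiv.swap a x.1 * x.2)
    (fun τ _ => (⟨τ a, Equiv.swap a (τ a) * τ⟩ : Σ _ : α, Equiv.Perm α)) ?_ ?_ ?_ ?_ ?_).symm
  · rintro ⟨j, τ⟩ h
    rw [Finset.mem_sigma] at h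
    exact swap_mul_mem_matchings ha h.1 h.2
  · intro τ h
    rw [Finset.mem_sigma]
    refine ⟨?_, swap_mul_mem_matchings_erase ha h⟩
    rw [mem_matchings] at h
    have h1 := (h.2 a).2 ha
    refine Finset.mem_erase.2 ⟨h1, (h.2 _).1 ?_⟩
    rw [h.1]; exact h1.symm
  · rintro ⟨j, τ⟩ h
    rw [Finset.mem_sigma] at h
    have : (Equiv.swap a j * τ) a = j := by rw [swap_mul_apply h.2, if_pos rfl]
    simp only [this, ← mul_assoc, Equiv.swap_mul_self, one_mul]
  · intro τ _
    simp only [← mul_assoc, Equiv.swap_mul_self, one_mul]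
  · rintro ⟨j, τ⟩ h
    rw [Finset.mem_sigma] at h
    obtain ⟨hj, hτ⟩ := h
    have key := swap_mul_apply hτ
    have hja := (Finset.mem_erase.1 hj).1
    simp only [matchingWeight]
    -- The pair occurs as both `f a j` and `f j a`, which the division by 2 reduces to one copy.
    rw [← exp_add, ← Finset.add_sum_erase S _ ha, ← Finset.add_sum_erase (S.erase a) _ hj,
      key a, key j, if_pos rfl, if_neg hja, if_pos rfl, hf j a]
    have : ∑ x ∈ (S.erase a).erase j, f x ((Equiv.swap a j * τ) x) =
        ∑ x ∈ (S.erase a).erase j, f x (τ x) := by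
      refine Finset.sum_congr rfl fun x hx => ?_
      simp only [Finset.mem_erase] at hx
      rw [key, if_neg hx.2.1, if_neg hx.1]
    rw [this]
    congr 1; ring

/-- Both sides satisfy the same recursion in S, the double factorial absorbing the factor `S.card`;
for empty S the integral is 2π. -/
theorem sum_matchingWeight_eq_integral (f : α → α → ℝ) (hf : ∀ x y, f x y = f y x)
    (w : α → ℝ × ℝ) (hw : ∀ x y, dot (w x) (w y) = exp (f x y)) (S : Finset α)
    (hS : Even S.card) :
    ∑ τ ∈ matchings S, matchingWeight f S τ =
      (Nat.doubleFactorial S.card : ℝ) / (2 * π) *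
        ∫ θ in -π..π, ∏ i ∈ S, circleForm (w i) θ := by
  induction hn : S.card using Nat.strong_induction_on generalizing S with
  | _ n ih =>
    rcases S.eq_empty_or_nonempty with rfl | ⟨a, ha⟩
    · have : matchings (∅ : Finset α) = {1} := by
        ext τ
        simp only [mem_matchings, Finset.mem_singleton, Finset.notMem_empty, iff_false, not_not]
        constructor
        · rintro ⟨-, h⟩; exact Equiv.ext h
        · rintro rfl; simp
      subst hn
      have hpi := pi_pos.ne'
      simp [this, matchingWeight]
      field_simp
      ring
    · have hcard : ∀ j ∈ S.erase a, ((S.erase a).erase j).card + 2 = n := by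
        intro j hj
        have h1 := Finset.card_erase_add_one hj
        have h2 := Finset.card_erase_add_one ha
        omega
      have hn0 : n ≠ 0 := by rw [← hn]; exact (Finset.card_pos.2 ⟨a, ha⟩).ne'
      obtain ⟨m, rfl⟩ : ∃ m, n = m + 2 := by
        rw [hn] at hS
        obtain ⟨k, hk⟩ := hS
        exact ⟨n - 2, by omega⟩
      have hstep := card_mul_integral_prod_circleForm S w ha
      rw [hn] at hstep
      rw [sum_matchingWeight_eq f hf ha, Nat.doubleFactorial_add_two, Nat.cast_mul,
        show (((m + 2 : ℕ) : ℝ) * (m.doubleFactorial : ℝ) / (2 * π) *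
          ∫ θ in -π..π, ∏ i ∈ S, circleForm (w i) θ) = (m.doubleFactorial : ℝ) / (2 * π) *
          (((m + 2 : ℕ) : ℝ) * ∫ θ in -π..π, ∏ i ∈ S, circleForm (w i) θ) by ring, hstep,
        Finset.mul_sum]
      refine Finset.sum_congr rfl fun j hj => ?_
      have hm : ((S.erase a).erase j).card = m := by have := hcard j hj; omega
      rw [ih m (by omega) _ (by rw [hn] at hS; rw [hm]; simpa [Nat.even_add] using hS) hm, hw]
      ring

end Matchings

/-! ### The averaged partition function as a ratio of circle integrals -/

section PartitionFunction

variable {N : ℕ} (d : Fin N → ℕ)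

theorem pairings_eq_matchings : pairings d = matchings (Finset.univ : Finset (HalfEdge d)) := by
  ext τ; simp [mem_matchings, pairings]

theorem card_halfEdge : (Finset.univ : Finset (HalfEdge d)).card = ∑ i, d i := by
  simp [Finset.card_univ]

theorem spin_eq_one_or (σ : Spins N) (i : Fin N) : spin σ i = 1 ∨ spin σ i = -1 := by
  rcases Int.units_eq_one_or (σ i) with h | h <;> simp [spin, h]

/-- The vector attached to a half-edge with spin `t`. The inner products of these vectors are the
edge weights `exp (β t t')`. -/
noncomputable def spinVector (β t : ℝ) : ℝ × ℝ := (√(cosh β), t * √(sinh β))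

theorem dot_spinVector {β : ℝ} (hβ : 0 ≤ β) {s t : ℝ} (hs : s = 1 ∨ s = -1)
    (ht : t = 1 ∨ t = -1) : dot (spinVector β s) (spinVector β t) = exp (β * (s * t)) := by
  have h1 : √(cosh β) * √(cosh β) = cosh β := mul_self_sqrt (cosh_pos β).le
  have h2 : √(sinh β) * √(sinh β) = sinh β := mul_self_sqrt (sinh_nonneg_iff.2 hβ)
  have h3 := cosh_add_sinh β
  have h4 := cosh_sub_sinh β
  simp only [dot, spinVector]
  rcases hs with rfl | rfl <;> rcases ht with rfl | rfl <;> ring_nf <;>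
    simp only [pow_two, h1, h2] <;> linarith

/-- The Wick formula with zero interaction and all vectors equal to (1, 0). -/
theorem card_pairings (hd : Even (∑ i, d i)) :
    ((pairings d).card : ℝ) = (Nat.doubleFactorial (∑ i, d i) : ℝ) / (2 * π) *
      ∫ θ in -π..π, cos θ ^ (∑ i, d i) := by
  have h := sum_matchingWeight_eq_integral (α := HalfEdge d) (fun _ _ => 0) (fun _ _ => rfl)
    (fun _ => (1, 0)) (fun _ _ => by simp [dot]) Finset.univ (by rwa [card_halfEdge])
  rw [card_halfEdge, ← pairings_eq_matchings] at h
  simpa [matchingWeight, circleForm] using h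

theorem sum_boltzmann (hd : Even (∑ i, d i)) {β : ℝ} (hβ : 0 ≤ β) (B : ℝ) (σ : Spins N) :
    ∑ τ ∈ pairings d, boltzmann β B τ σ = (Nat.doubleFactorial (∑ i, d i) : ℝ) / (2 * π) *
      ∫ θ in -π..π, ∏ i, exp (B * spin σ i) * circleForm (spinVector β (spin σ i)) θ ^ d i := by
  have h := sum_matchingWeight_eq_integral (α := HalfEdge d)
    (fun x y => β * (spin σ x.1 * spin σ y.1)) (fun x y => by ring)
    (fun x => spinVector β (spin σ x.1))
    (fun x y => dot_spinVector hβ (spin_eq_one_or σ _) (spin_eq_one_or σ _))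
    Finset.univ (by rwa [card_halfEdge])
  rw [card_halfEdge, ← pairings_eq_matchings] at h
  have hb : ∀ τ : Equiv.Perm (HalfEdge d), boltzmann β B τ σ =
      exp (B * totalSpin σ) * matchingWeight
        (fun x y : HalfEdge d => β * (spin σ x.1 * spin σ y.1)) Finset.univ τ := by
    intro τ
    rw [boltzmann, matchingWeight, ← exp_add, edgeSum, ← Finset.mul_sum]
    congr 1; ring
  simp only [hb]
  rw [← Finset.mul_sum, h, mul_left_comm, ← intervalIntegral.integral_const_mul]
  congr 1
  refine intervalIntegral.integral_congr fun θ _ => ?_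
  simp only [Finset.prod_mul_distrib]
  rw [← exp_sum, ← Finset.mul_sum, totalSpin, Fintype.prod_sigma]
  simp

/-- The total weight of a vertex of degree `k`, in the direction `θ`. -/
noncomputable def vertexWeight (β B : ℝ) (k : ℕ) (θ : ℝ) : ℝ :=
  exp B * circleForm (spinVector β 1) θ ^ k + exp (-B) * circleForm (spinVector β (-1)) θ ^ k

theorem sum_prod_spins (β B θ : ℝ) :
    ∑ σ : Spins N, ∏ i, exp (B * spin σ i) * circleForm (spinVector β (spin σ i)) θ ^ d i =
      ∏ i, vertexWeight β B (d i) θ := by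
  have h := (Finset.prod_univ_sum (fun _ : Fin N => (Finset.univ : Finset ℤˣ))
    (fun i t => exp (B * ((t : ℤ) : ℝ)) * circleForm (spinVector β ((t : ℤ) : ℝ)) θ ^ d i)).symm
  rw [Fintype.piFinset_univ] at h
  refine h.trans (Finset.prod_congr rfl fun i _ => ?_)
  rw [show (Finset.univ : Finset ℤˣ) = {1, -1} from rfl, Finset.sum_pair (by decide)]
  simp [vertexWeight]

theorem graphExpect_partitionFn (hd : Even (∑ i, d i)) {β : ℝ} (hβ : 0 ≤ β) (B : ℝ) :
    graphExpect d (partitionFn β B) =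
      (∫ θ in -π..π, ∏ i, vertexWeight β B (d i) θ) / ∫ θ in -π..π, cos θ ^ (∑ i, d i) := by
  have hK : (Nat.doubleFactorial (∑ i, d i) : ℝ) / (2 * π) ≠ 0 :=
    div_ne_zero (Nat.cast_ne_zero.2 (Nat.doubleFactorial_pos _).ne') (by positivity)
  rw [graphExpect, card_pairings d hd]
  simp only [partitionFn]
  rw [Finset.sum_comm]
  simp only [sum_boltzmann d hd hβ]
  rw [← Finset.mul_sum, mul_div_mul_left _ _ hK, ← intervalIntegral.integral_finsetSum]
  · simp only [sum_prod_spins]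
  · intro σ _
    apply Continuous.intervalIntegrable
    fun_prop

end PartitionFunction

/-! ### Laplace asymptotics with a certified maximum -/

section Laplace

variable {A D : ℝ → ℝ} {p θ₀ : ℝ}

theorem pow_le_exp_mul_sub_one {x : ℝ} (hx : 0 ≤ x) (n : ℕ) : x ^ n ≤ exp (n * (x - 1)) := by
  rw [exp_nat_mul]
  refine pow_le_pow_left₀ hx ?_ n
  linarith [add_one_le_exp (x - 1)]

theorem exists_integral_le (hA : Continuous A) (hD : Continuous D) (hD0 : ∀ θ, 0 ≤ D θ)
    (hA₀ : 0 < A θ₀) (hD₀ : 0 < D θ₀)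
    (hcert : ∀ θ, (1 - p) * (A θ ^ 2 / A θ₀ ^ 2) + 2 * p * (D θ / D θ₀) ≤ 1 + p) :
    ∃ K : ℝ, ∀ n m : ℕ, Even n → (m : ℝ) ≤ p * (n + m) → p * (n + m) ≤ m + 1 →
      ∫ θ in -π..π, A θ ^ n * D θ ^ m ≤ exp K * (A θ₀ ^ n * D θ₀ ^ m) := by
  obtain ⟨C, hC⟩ := (isCompact_Icc (a := -π) (b := π)).bddAbove_image
    (f := fun θ => A θ ^ 2 / A θ₀ ^ 2) (by fun_prop)
  have hC' : ∀ θ ∈ Set.Icc (-π) π, A θ ^ 2 / A θ₀ ^ 2 ≤ C := fun θ hθ =>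
    hC (Set.mem_image_of_mem _ hθ)
  have hpi := pi_pos
  refine ⟨log (2 * π) + (C / 2 + 1), fun n m hn h1 h2 => ?_⟩
  have hpt : ∀ θ ∈ Set.Icc (-π) π, A θ ^ n * D θ ^ m ≤
      exp (C / 2 + 1) * (A θ₀ ^ n * D θ₀ ^ m) := by
    intro θ hθ
    obtain ⟨k, rfl⟩ := hn
    set a := A θ ^ 2 / A θ₀ ^ 2 with ha
    set b := D θ / D θ₀ with hb
    have ha0 : 0 ≤ a := by positivity
    have hb0 : 0 ≤ b := div_nonneg (hD0 θ) hD₀.le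
    have e1 : A θ ^ (k + k) = a ^ k * A θ₀ ^ (k + k) := by
      rw [ha, div_pow, ← pow_mul, ← pow_mul, two_mul, div_mul_cancel₀]
      positivity
    have e2 : D θ ^ m = b ^ m * D θ₀ ^ m := by
      rw [hb, div_pow, div_mul_cancel₀]; positivity
    have hle : a ^ k * b ^ m ≤ exp (C / 2 + 1) := by
      calc a ^ k * b ^ m ≤ exp (k * (a - 1)) * exp (m * (b - 1)) :=
            mul_le_mul (pow_le_exp_mul_sub_one ha0 k) (pow_le_exp_mul_sub_one hb0 m)
              (by positivity) (by positivity)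
        _ ≤ exp (C / 2 + 1) := by
          rw [← exp_add]
          apply exp_le_exp.2
          have hc := hcert θ
          have hCa := hC' θ hθ
          push_cast at h1 h2
          -- The rounding error of the floor, in [0, 1]. It perturbs the certificate by a bounded
          -- amount, whence the constant C / 2 + 1.
          set δ := p * ((k : ℝ) + k + m) - m with hδ
          have hN : (0 : ℝ) ≤ k + k + m := by positivity
          have h3 := mul_le_mul_of_nonneg_left hc hN
          have h4 : δ * a ≤ C := by
            have : δ * a ≤ 1 * a := mul_le_mul_of_nonneg_right (by linarith) ha0
            linarith
          have h5 : 0 ≤ δ * b := mul_nonneg (by linarith) hb0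
          have h6 : 2 * ((k : ℝ) * (a - 1) + m * (b - 1)) =
            ((k : ℝ) + k + m) * ((1 - p) * a + 2 * p * b - (1 + p)) + δ * a - 2 * (δ * b) + δ := by
            rw [hδ]; ring
          linarith
    rw [e1, e2]
    calc a ^ k * A θ₀ ^ (k + k) * (b ^ m * D θ₀ ^ m)
        = (a ^ k * b ^ m) * (A θ₀ ^ (k + k) * D θ₀ ^ m) := by ring
      _ ≤ _ := mul_le_mul_of_nonneg_right hle (by positivity)
  have hI := intervalIntegral.integral_mono_on (μ := MeasureTheory.volume)
    (a := -π) (b := π) (by linarith)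
    (f := fun θ => A θ ^ n * D θ ^ m)
    (g := fun _ => exp (C / 2 + 1) * (A θ₀ ^ n * D θ₀ ^ m))
    (by apply Continuous.intervalIntegrable; fun_prop) (by simp) hpt
  refine hI.trans (le_of_eq ?_)
  rw [intervalIntegral.integral_const, exp_add (log _), exp_log (by positivity), smul_eq_mul]
  ring

theorem exists_le_integral (hA : Continuous A) (hD : Continuous D) (hD0 : ∀ θ, 0 ≤ D θ)
    (hA₀ : 0 < A θ₀) (hD₀ : 0 < D θ₀) (hθ₀ : θ₀ ∈ Set.Ioo (-π) π) {ε : ℝ} (hε : 0 < ε) :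
    ∃ K : ℝ, ∀ n m : ℕ, Even n →
      exp (-K - ε * (n + m)) * (A θ₀ ^ n * D θ₀ ^ m) ≤ ∫ θ in -π..π, A θ ^ n * D θ ^ m := by
  have hlt : exp (-ε) < 1 := by rw [← exp_zero]; exact exp_lt_exp.2 (by linarith)
  have h1 : ∀ᶠ θ in 𝓝 θ₀, exp (-ε) * A θ₀ < A θ :=
    hA.continuousAt.eventually_const_lt (by nlinarith)
  have h2 : ∀ᶠ θ in 𝓝 θ₀, exp (-ε) * D θ₀ < D θ :=
    hD.continuousAt.eventually_const_lt (by nlinarith)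
  have h3 : ∀ᶠ θ in 𝓝 θ₀, θ ∈ Set.Ioo (-π) π := isOpen_Ioo.mem_nhds hθ₀
  obtain ⟨r, hr, hball⟩ := Metric.eventually_nhds_iff_ball.1 (h1.and (h2.and h3))
  set u := θ₀ - r / 2
  set v := θ₀ + r / 2
  have huv : u ≤ v := by simp only [u, v]; linarith
  have hmem : ∀ θ ∈ Set.Icc u v, exp (-ε) * A θ₀ < A θ ∧ exp (-ε) * D θ₀ < D θ ∧
      θ ∈ Set.Ioo (-π) π := by
    intro θ hθ
    apply hball
    rw [Metric.mem_ball, dist_eq, abs_lt]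
    simp only [u, v, Set.mem_Icc] at hθ
    constructor <;> linarith
  -- exp (-K) is the length r of the interval on which both factors stay within exp (-ε) of their
  -- values at θ₀. Evenness of n lets the rest of the circle be dropped.
  refine ⟨-log r, fun n m hn => ?_⟩
  have hnn : ∀ θ, 0 ≤ A θ ^ n * D θ ^ m := fun θ =>
    mul_nonneg (hn.pow_nonneg _) (pow_nonneg (hD0 θ) _)
  have hint : ∀ a b, IntervalIntegrable (fun θ => A θ ^ n * D θ ^ m) MeasureTheory.volume a b :=
    fun a b => by apply Continuous.intervalIntegrable; fun_prop
  have hsub : ∫ θ in u..v, A θ ^ n * D θ ^ m ≤ ∫ θ in -π..π, A θ ^ n * D θ ^ m :=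
    intervalIntegral.integral_mono_interval (hmem u ⟨le_rfl, huv⟩).2.2.1.le huv
      (hmem v ⟨huv, le_rfl⟩).2.2.2.le (Eventually.of_forall hnn) (hint _ _)
  refine le_trans ?_ hsub
  have hI := intervalIntegral.integral_mono_on (μ := MeasureTheory.volume) huv
    (f := fun _ => (exp (-ε) * A θ₀) ^ n * (exp (-ε) * D θ₀) ^ m)
    (g := fun θ => A θ ^ n * D θ ^ m) (by simp) (hint _ _) (fun θ hθ => by
      obtain ⟨ha, hb, -⟩ := hmem θ hθ
      have : 0 ≤ A θ ^ n := hn.pow_nonneg _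
      gcongr)
  refine le_trans (le_of_eq ?_) hI
  rw [intervalIntegral.integral_const, smul_eq_mul, mul_pow, mul_pow, ← exp_nat_mul, ← exp_nat_mul,
    show v - u = r by simp only [u, v]; ring, show - -log r - ε * ((n : ℝ) + m) =
      log r + (n * -ε + m * -ε) by ring, exp_add, exp_add, exp_log hr]
  ring

theorem integral_pow_mul_pow_pos (hA : Continuous A) (hD : Continuous D) (hD0 : ∀ θ, 0 ≤ D θ)
    (hA₀ : 0 < A θ₀) (hD₀ : 0 < D θ₀) (hθ₀ : θ₀ ∈ Set.Ioo (-π) π) {n : ℕ} (hn : Even n) (m : ℕ) :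
    0 < ∫ θ in -π..π, A θ ^ n * D θ ^ m := by
  obtain ⟨K, hK⟩ := exists_le_integral hA hD hD0 hA₀ hD₀ hθ₀ one_pos
  exact lt_of_lt_of_le (by positivity) (hK n m hn)

theorem floor_mul_le_self (hp : p ∈ Set.Icc (0 : ℝ) 1) (N : ℕ) : ⌊p * N⌋₊ ≤ N := by
  have : p * N ≤ N := mul_le_of_le_one_left (by positivity) hp.2
  exact Nat.floor_le_of_le this

theorem tendsto_floor_mul_div (hp : p ∈ Set.Icc (0 : ℝ) 1) :
    Tendsto (fun N : ℕ => (⌊p * N⌋₊ : ℝ) / N) atTop (𝓝 p) :=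
  (tendsto_nat_floor_mul_div_atTop hp.1).comp tendsto_natCast_atTop_atTop

/-- Laplace's method for the integrals of `A ^ n * D ^ m` over the circle, where the maximum
is certified by a quadratic inequality. -/
theorem tendsto_log_integral_div (hp : p ∈ Set.Icc (0 : ℝ) 1) (hA : Continuous A)
    (hD : Continuous D) (hD0 : ∀ θ, 0 ≤ D θ)
    (hA₀ : 0 < A θ₀) (hD₀ : 0 < D θ₀) (hθ₀ : θ₀ ∈ Set.Ioo (-π) π)
    (hcert : ∀ θ, (1 - p) * (A θ ^ 2 / A θ₀ ^ 2) + 2 * p * (D θ / D θ₀) ≤ 1 + p)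
    {F : Filter ℕ} (hF : F ≤ atTop) (heven : ∀ᶠ N : ℕ in F, Even (N - ⌊p * N⌋₊)) :
    Tendsto (fun N : ℕ => log (∫ θ in -π..π, A θ ^ (N - ⌊p * N⌋₊) * D θ ^ ⌊p * N⌋₊) / N) F
      (𝓝 ((1 - p) * log (A θ₀) + p * log (D θ₀))) := by
  set I : ℕ → ℝ := fun N => ∫ θ in -π..π, A θ ^ (N - ⌊p * N⌋₊) * D θ ^ ⌊p * N⌋₊ with hI
  set T : ℕ → ℝ := fun N => (1 - (⌊p * N⌋₊ : ℝ) / N) * log (A θ₀) +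
    (⌊p * N⌋₊ : ℝ) / N * log (D θ₀) with hT
  have hTlim : Tendsto T F (𝓝 ((1 - p) * log (A θ₀) + p * log (D θ₀))) := by
    have h := (tendsto_floor_mul_div hp).mono_left hF
    exact ((tendsto_const_nhds.sub h).mul_const _).add (h.mul_const _)
  have hlogT : ∀ N : ℕ, 0 < N →
      log (A θ₀ ^ (N - ⌊p * N⌋₊) * D θ₀ ^ ⌊p * N⌋₊) = N * T N := by
    intro N hN
    have hN' : (N : ℝ) ≠ 0 := by positivity
    rw [log_mul (by positivity) (by positivity), log_pow, log_pow,
      Nat.cast_sub (floor_mul_le_self hp N), hT]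
    field_simp
  have hcastadd : ∀ N : ℕ, ((N - ⌊p * N⌋₊ : ℕ) : ℝ) + (⌊p * N⌋₊ : ℝ) = N := by
    intro N
    rw [Nat.cast_sub (floor_mul_le_self hp N)]; ring
  have hdiv : ∀ K : ℝ, Tendsto (fun N : ℕ => K / (N : ℝ)) F (𝓝 0) := fun K =>
    (tendsto_const_div_atTop_nhds_zero_nat K).mono_left hF
  obtain ⟨K, hK⟩ := exists_integral_le hA hD hD0 hA₀ hD₀ hcert
  have hpos : ∀ᶠ N : ℕ in F, 0 < N := hF (eventually_gt_atTop 0)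
  have hupper : ∀ᶠ N : ℕ in F, log (I N) / N ≤ T N + K / N := by
    filter_upwards [hpos, heven] with N hN he
    have hIpos : 0 < I N := integral_pow_mul_pow_pos hA hD hD0 hA₀ hD₀ hθ₀ he _
    have h := hK _ _ he (by rw [hcastadd]; exact Nat.floor_le (mul_nonneg hp.1 (by positivity)))
      (by rw [hcastadd]; exact (Nat.lt_floor_add_one _).le)
    have h' := log_le_log hIpos h
    rw [log_mul (by positivity) (by positivity), log_exp, hlogT N hN] at h'
    rw [div_le_iff₀ (by positivity)]
    have : (T N + K / N) * N = K + N * T N := by field_simp; ring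
    linarith
  have hlower : ∀ ε > 0, ∃ K' : ℝ, ∀ᶠ N : ℕ in F, T N - K' / N - ε ≤ log (I N) / N := by
    intro ε hε
    obtain ⟨K', hK'⟩ := exists_le_integral hA hD hD0 hA₀ hD₀ hθ₀ hε
    refine ⟨K', ?_⟩
    filter_upwards [hpos, heven] with N hN he
    have h := hK' (N - ⌊p * N⌋₊) ⌊p * N⌋₊ he
    rw [hcastadd] at h
    have h' := log_le_log (by positivity) h
    rw [log_mul (by positivity) (by positivity), log_exp, hlogT N hN] at h'
    rw [le_div_iff₀ (by positivity)]
    have : (T N - K' / N - ε) * N = -K' - ε * N + N * T N := by field_simp; ring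
    linarith
  rw [tendsto_order]
  constructor
  · intro a ha
    set l := (1 - p) * log (A θ₀) + p * log (D θ₀)
    obtain ⟨K', hK'⟩ := hlower ((l - a) / 2) (by linarith)
    have hlim : Tendsto (fun N : ℕ => T N - K' / N - (l - a) / 2) F
        (𝓝 (l - 0 - (l - a) / 2)) := (hTlim.sub (hdiv K')).sub_const _
    filter_upwards [hK', hlim.eventually_const_lt (show a < _ by linarith)] with N h1 h2
    linarith
  · intro b hb
    have hlim : Tendsto (fun N : ℕ => T N + K / N) F
        (𝓝 ((1 - p) * log (A θ₀) + p * log (D θ₀) + 0)) := hTlim.add (hdiv K)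
    filter_upwards [hupper, hlim.eventually_lt_const (show _ < b by linarith)] with N h1 h2
    linarith

end Laplace

/-! ### The optimal direction and differentiability in the field -/

section Optimizer

/-- A symmetric `2 × 2` matrix with positive off-diagonal entry: the Rayleigh quotient at an
eigenvector in the closed first quadrant is larger than the one at the orthogonal vector. -/
theorem quadForm_orthogonal_lt {r s t u v : ℝ} (hu : 0 ≤ u) (hv : 0 ≤ v) (huv : u ^ 2 + v ^ 2 = 1)
    (hs : 0 < s) (hcrit : t * (u * v) + s * (u ^ 2 - v ^ 2) - r * (u * v) = 0) :
    r * v ^ 2 - 2 * s * (u * v) + t * u ^ 2 < r * u ^ 2 + 2 * s * (u * v) + t * v ^ 2 := by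
  have h : (u * v) * ((r * u ^ 2 + 2 * s * (u * v) + t * v ^ 2) -
      (r * v ^ 2 - 2 * s * (u * v) + t * u ^ 2)) = s := by
    linear_combination (-(u ^ 2 - v ^ 2)) * hcrit + s * (u ^ 2 + v ^ 2 + 1) * huv
  rw [← h] at hs
  linarith [pos_of_mul_pos_right hs (mul_nonneg hu hv)]

/-- The form of degree one in `e = (u, v)`: the total weight of a vertex of degree one. -/
noncomputable def lin (β B u v : ℝ) : ℝ :=
  exp B * (√(cosh β) * u + √(sinh β) * v) + exp (-B) * (√(cosh β) * u - √(sinh β) * v)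

/-- The symmetric bilinear form whose quadratic form is the total weight of a vertex of
degree two. -/
noncomputable def bil (β B u v u' v' : ℝ) : ℝ :=
  exp B * ((√(cosh β) * u + √(sinh β) * v) * (√(cosh β) * u' + √(sinh β) * v')) +
    exp (-B) * ((√(cosh β) * u - √(sinh β) * v) * (√(cosh β) * u' - √(sinh β) * v'))

theorem vertexWeight_one (β B θ : ℝ) : vertexWeight β B 1 θ = lin β B (cos θ) (sin θ) := by
  simp only [vertexWeight, circleForm, spinVector, lin]; ring

theorem vertexWeight_two (β B θ : ℝ) :
    vertexWeight β B 2 θ = bil β B (cos θ) (sin θ) (cos θ) (sin θ) := by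
  simp only [vertexWeight, circleForm, spinVector, bil]; ring

/-- `θ` is a nondegenerate critical direction of
`(1 - p) * log lin + p * log bil` along the circle at which a quadratic majorant is maximal. -/
structure IsOptimal (p β B θ : ℝ) : Prop where
  lin_pos : 0 < lin β B (cos θ) (sin θ)
  bil_pos : 0 < bil β B (cos θ) (sin θ) (cos θ) (sin θ)
  crit : (1 - p) * (lin β B (cos θ) (sin θ) * lin β B (-sin θ) (cos θ)) /
      lin β B (cos θ) (sin θ) ^ 2 + 2 * p * bil β B (cos θ) (sin θ) (-sin θ) (cos θ) /
      bil β B (cos θ) (sin θ) (cos θ) (sin θ) = 0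
  gap : (1 - p) * lin β B (-sin θ) (cos θ) ^ 2 / lin β B (cos θ) (sin θ) ^ 2 +
      2 * p * bil β B (-sin θ) (cos θ) (-sin θ) (cos θ) /
      bil β B (cos θ) (sin θ) (cos θ) (sin θ) < 1 + p

variable {p β B θ : ℝ}

theorem IsOptimal.neg (h : IsOptimal p β B θ) : IsOptimal p β (-B) (-θ) := by
  obtain ⟨h1, h2, h3, h4⟩ := h
  have e1 : lin β (-B) (cos (-θ)) (sin (-θ)) = lin β B (cos θ) (sin θ) := by
    simp only [lin, cos_neg, sin_neg, neg_neg]; ring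
  have e2 : lin β (-B) (-sin (-θ)) (cos (-θ)) = -lin β B (-sin θ) (cos θ) := by
    simp only [lin, cos_neg, sin_neg, neg_neg]; ring
  have e3 : bil β (-B) (cos (-θ)) (sin (-θ)) (cos (-θ)) (sin (-θ)) =
      bil β B (cos θ) (sin θ) (cos θ) (sin θ) := by
    simp only [bil, cos_neg, sin_neg, neg_neg]; ring
  have e4 : bil β (-B) (cos (-θ)) (sin (-θ)) (-sin (-θ)) (cos (-θ)) =
      -bil β B (cos θ) (sin θ) (-sin θ) (cos θ) := by
    simp only [bil, cos_neg, sin_neg, neg_neg]; ring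
  have e5 : bil β (-B) (-sin (-θ)) (cos (-θ)) (-sin (-θ)) (cos (-θ)) =
      bil β B (-sin θ) (cos θ) (-sin θ) (cos θ) := by
    simp only [bil, cos_neg, sin_neg, neg_neg]; ring
  refine ⟨by rwa [e1], by rwa [e3], ?_, ?_⟩
  · rw [e1, e2, e3, e4]
    linear_combination -h3
  · rwa [e1, e2, e3, e5, neg_sq]

theorem isOptimal_zero (hp : p ∈ Set.Icc (0 : ℝ) 1) (h : β = 0 ∨ B = 0) :
    IsOptimal p β B 0 := by
  have hc : √(cosh β) ^ 2 = cosh β := sq_sqrt (cosh_pos β).le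
  have hc0 : 0 < √(cosh β) := sqrt_pos.2 (cosh_pos β)
  have hs : √(sinh β) ^ 2 < √(cosh β) ^ 2 := by
    rw [hc]
    rcases le_total 0 (sinh β) with h0 | h0
    · rw [sq_sqrt h0]; exact sinh_lt_cosh β
    · rw [sqrt_eq_zero'.2 h0]; simpa using cosh_pos β
  -- Every off-diagonal term carries this factor, so θ = 0 is critical; the gap then reduces to tanh
  -- β < 1.
  have h0 : √(sinh β) * (exp B - exp (-B)) = 0 := by
    rcases h with rfl | rfl <;> simp
  have hk := exp_pos B
  have hj := exp_pos (-B)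
  set c := √(cosh β) with hcdef
  set s := √(sinh β) with hsdef
  have e1 : lin β B 1 0 = c * (exp B + exp (-B)) := by simp only [lin]; ring
  have e2 : lin β B 0 1 = 0 := by simp only [lin]; linear_combination h0
  have e3 : bil β B 1 0 1 0 = c ^ 2 * (exp B + exp (-B)) := by simp only [bil]; ring
  have e4 : bil β B 1 0 0 1 = 0 := by simp only [bil]; linear_combination c * h0
  have e5 : bil β B 0 1 0 1 = s ^ 2 * (exp B + exp (-B)) := by simp only [bil]; ring
  refine ⟨?_, ?_, ?_, ?_⟩ <;> simp only [cos_zero, sin_zero, neg_zero]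
  · rw [e1]; positivity
  · rw [e3]; positivity
  · rw [e2, e4]; simp
  · rw [e2, e5, e3]
    have : 2 * p * (s ^ 2 * (exp B + exp (-B))) / (c ^ 2 * (exp B + exp (-B))) =
        2 * p * (s ^ 2 / c ^ 2) := by field_simp
    rw [this]
    have hlt : s ^ 2 / c ^ 2 < 1 := (div_lt_one (by positivity)).2 hs
    have hnn : 0 ≤ s ^ 2 / c ^ 2 := by positivity
    obtain ⟨hp0, hp1⟩ := hp
    simp only [ne_eq, OfNat.ofNat_ne_zero, not_false_eq_true, zero_pow, mul_zero, zero_div,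
      zero_add]
    rcases hp0.eq_or_lt with rfl | hp0
    · simp
    · nlinarith

theorem exists_isOptimal_of_pos (hp : p ∈ Set.Icc (0 : ℝ) 1) (hβ : 0 < β) (hB : 0 < B) :
    ∃ θ ∈ Set.Icc (-(π / 2)) (π / 2), IsOptimal p β B θ := by
  obtain ⟨hp0, hp1⟩ := hp
  have hc : 0 < √(cosh β) := sqrt_pos.2 (cosh_pos β)
  have hs : 0 < √(sinh β) := sqrt_pos.2 (sinh_pos_iff.2 hβ)
  have hj : 0 < exp (-B) := exp_pos _
  have hkj : 0 < exp B - exp (-B) := sub_pos.2 (exp_lt_exp.2 (by linarith))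
  have hk : 0 < exp B := exp_pos _
  have hp1' : 0 ≤ 1 - p := by linarith
  have hl : ∀ u v, lin β B u v = √(cosh β) * u * (exp B + exp (-B)) +
      √(sinh β) * v * (exp B - exp (-B)) := by
    intro u v; simp only [lin]; ring
  have hb : ∀ u v u' v', bil β B u v u' v' =
      (√(cosh β) ^ 2 * (u * u') + √(sinh β) ^ 2 * (v * v')) * (exp B + exp (-B)) +
      √(cosh β) * √(sinh β) * (u * v' + u' * v) * (exp B - exp (-B)) := by
    intro u v u' v'; simp only [bil]; ring
  set c := √(cosh β)
  set s := √(sinh β)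
  set k := exp B + exp (-B) with hkdef
  set j := exp B - exp (-B) with hjdef
  have hk' : 0 < k := by positivity
  -- The derivative of (1 - p) log A + p log D along the circle, cleared of denominators.
  set G : ℝ → ℝ := fun θ =>
    (1 - p) * lin β B (-sin θ) (cos θ) * bil β B (cos θ) (sin θ) (cos θ) (sin θ) +
      2 * p * bil β B (cos θ) (sin θ) (-sin θ) (cos θ) * lin β B (cos θ) (sin θ) with hG
  have hGc : Continuous G := by simp only [hG, lin, bil]; fun_prop
  have hG0 : 0 ≤ G 0 := by
    simp only [hG, hl, hb, cos_zero, sin_zero]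
    have : 0 ≤ (1 - p) * (s * j) * (c ^ 2 * k) + 2 * p * (c * s * j) * (c * k) := by positivity
    convert this using 1; ring
  have hG1 : G (π / 2) ≤ 0 := by
    simp only [hG, hl, hb, cos_pi_div_two, sin_pi_div_two]
    have : 0 ≤ (1 - p) * (c * k) * (s ^ 2 * k) + 2 * p * (c * s * j) * (s * j) := by positivity
    rw [← neg_nonneg]
    convert this using 1; ring
  have hpi := pi_pos
  obtain ⟨θ, hθ, hGθ⟩ := intermediate_value_Icc' (by positivity : (0 : ℝ) ≤ π / 2)
    hGc.continuousOn ⟨hG1, hG0⟩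
  refine ⟨θ, ⟨by linarith [hθ.1], hθ.2⟩, ?_⟩
  have hu : 0 ≤ cos θ := cos_nonneg_of_mem_Icc ⟨by linarith [hθ.1], hθ.2⟩
  have hv : 0 ≤ sin θ := sin_nonneg_of_mem_Icc ⟨hθ.1, by linarith [hθ.2]⟩
  have huv : cos θ ^ 2 + sin θ ^ 2 = 1 := cos_sq_add_sin_sq θ
  simp only [hG] at hGθ
  refine (fun H => ⟨H.1, H.2.1, H.2.2.1, H.2.2.2⟩ : (_ ∧ _ ∧ _ ∧ _) → IsOptimal p β B θ) ?_
  generalize cos θ = u at *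
  generalize sin θ = v at *
  have hA : 0 < lin β B u v := by
    rw [hl]
    rcases hu.eq_or_lt with rfl | hu
    · have : 0 < v := lt_of_le_of_ne hv (by rintro rfl; simp at huv)
      simp; positivity
    · positivity
  have hD : 0 < bil β B u v u v := by
    rw [hb]
    rcases hu.eq_or_lt with rfl | hu
    · have : 0 < v := lt_of_le_of_ne hv (by rintro rfl; simp at huv)
      simp; positivity
    · positivity
  -- The normalizations are made opaque so that expanding the forms leaves the denominators alone.
  obtain ⟨a, ha⟩ : ∃ a, a = lin β B u v := ⟨_, rfl⟩
  obtain ⟨e, he⟩ : ∃ e, e = bil β B u v u v := ⟨_, rfl⟩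
  rw [← ha] at hA
  rw [← he] at hD
  have hcrit : (1 - p) * (lin β B u v * lin β B (-v) u) / a ^ 2 +
      2 * p * bil β B u v (-v) u / e = 0 := by
    rw [← ha, ← he] at hGθ
    rw [← ha]
    field_simp
    linear_combination hGθ
  rw [← ha, ← he]
  refine ⟨hA, hD, by rwa [← ha] at hcrit, ?_⟩
  have key := quadForm_orthogonal_lt (u := u) (v := v)
    (r := (1 - p) * lin β B 1 0 ^ 2 / a ^ 2 + 2 * p * bil β B 1 0 1 0 / e)
    (s := (1 - p) * (lin β B 1 0 * lin β B 0 1) / a ^ 2 + 2 * p * bil β B 1 0 0 1 / e)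
    (t := (1 - p) * lin β B 0 1 ^ 2 / a ^ 2 + 2 * p * bil β B 0 1 0 1 / e) hu hv huv ?_ ?_
  · have h1 : (1 - p) * lin β B u v ^ 2 / a ^ 2 + 2 * p * bil β B u v u v / e = 1 + p := by
      rw [← ha, ← he]; field_simp; ring
    calc _ = _ := ?_
      _ < _ := key
      _ = _ := ?_
      _ = 1 + p := h1
    · simp only [hl, hb]; ring
    · simp only [hl, hb]; ring
  · simp only [hl, hb]
    have h1 : 0 < c * k * (s * j) / a ^ 2 := by positivity
    have h2 : 0 < c * s * j / e := by positivity
    have : 0 < (1 - p) * (c * k * (s * j) / a ^ 2) + 2 * p * (c * s * j / e) := by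
      rcases hp0.eq_or_lt with rfl | hp0
      · simpa using h1
      · positivity
    convert this using 1; ring
  · refine Eq.trans ?_ hcrit
    simp only [hl, hb]; ring

theorem exists_isOptimal (hp : p ∈ Set.Icc (0 : ℝ) 1) (hβ : 0 ≤ β) (B : ℝ) :
    ∃ θ ∈ Set.Icc (-(π / 2)) (π / 2), IsOptimal p β B θ := by
  have hpi := pi_pos
  by_cases h : β = 0 ∨ B = 0
  · exact ⟨0, ⟨by linarith, by linarith⟩, isOptimal_zero hp h⟩
  · push Not at h
    have hβ' := lt_of_le_of_ne hβ h.1.symm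
    rcases lt_or_gt_of_ne h.2 with hB | hB
    · obtain ⟨θ, hθ, ho⟩ := exists_isOptimal_of_pos hp hβ' (neg_pos.2 hB)
      exact ⟨-θ, ⟨by linarith [hθ.2], by linarith [hθ.1]⟩, by simpa using ho.neg⟩
    · exact exists_isOptimal_of_pos hp hβ' hB

/-- The function whose maximum over the circle is the annealed pressure. -/
noncomputable def pressureFn (p β B θ : ℝ) : ℝ :=
  (1 - p) * log (lin β B (cos θ) (sin θ)) + p * log (bil β B (cos θ) (sin θ) (cos θ) (sin θ))

/-- The quadratic majorant, normalized at `(B, θ)`, of the weights with external field `B'`,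
as a bilinear form in `(u, v)` and `(u', v')`. -/
noncomputable def majorant (p β B θ B' u v u' v' : ℝ) : ℝ :=
  (1 - p) * (lin β B' u v * lin β B' u' v') / lin β B (cos θ) (sin θ) ^ 2 +
    2 * p * bil β B' u v u' v' / bil β B (cos θ) (sin θ) (cos θ) (sin θ)

/-- A smooth upper bound for the largest eigenvalue of the majorant. -/
noncomputable def eigenBound (p β B θ B' : ℝ) : ℝ :=
  majorant p β B θ B' (cos θ) (sin θ) (cos θ) (sin θ) +
    majorant p β B θ B' (cos θ) (sin θ) (-sin θ) (cos θ) ^ 2 /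
      (majorant p β B θ B' (cos θ) (sin θ) (cos θ) (sin θ) -
        majorant p β B θ B' (-sin θ) (cos θ) (-sin θ) (cos θ))

/-- In the orthonormal frame at θ the form has matrix [[m, q], [q, n]], and (m - n) times the defect
is a sum of two squares. The correction q² / (m - n) vanishes at B' = B by criticality. -/
theorem majorant_le_eigenBound {B' : ℝ}
    (hgap : majorant p β B θ B' (-sin θ) (cos θ) (-sin θ) (cos θ) <
      majorant p β B θ B' (cos θ) (sin θ) (cos θ) (sin θ)) (φ : ℝ) :
    majorant p β B θ B' (cos φ) (sin φ) (cos φ) (sin φ) ≤ eigenBound p β B θ B' := by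
  set x := cos (φ - θ) with hx
  set y := sin (φ - θ) with hy
  have hxy : x ^ 2 + y ^ 2 = 1 := cos_sq_add_sin_sq _
  have hcos : cos φ = x * cos θ - y * sin θ := by
    rw [hx, hy, ← cos_add]; congr 1; ring
  have hsin : sin φ = x * sin θ + y * cos θ := by
    rw [hx, hy, add_comm, ← sin_add]; congr 1; ring
  have hexp : majorant p β B θ B' (cos φ) (sin φ) (cos φ) (sin φ) =
      x ^ 2 * majorant p β B θ B' (cos θ) (sin θ) (cos θ) (sin θ) +
      2 * (x * y) * majorant p β B θ B' (cos θ) (sin θ) (-sin θ) (cos θ) +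
      y ^ 2 * majorant p β B θ B' (-sin θ) (cos θ) (-sin θ) (cos θ) := by
    rw [hcos, hsin]
    simp only [majorant, mul_div_assoc]
    generalize lin β B (cos θ) (sin θ) = a
    generalize bil β B (cos θ) (sin θ) (cos θ) (sin θ) = e
    simp only [lin, bil]; ring
  rw [hexp, eigenBound]
  set m := majorant p β B θ B' (cos θ) (sin θ) (cos θ) (sin θ)
  set q := majorant p β B θ B' (cos θ) (sin θ) (-sin θ) (cos θ)
  set n := majorant p β B θ B' (-sin θ) (cos θ) (-sin θ) (cos θ)
  have hg : 0 < m - n := sub_pos.2 hgap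
  have h1 : (m - n) * (q ^ 2 / (m - n)) = q ^ 2 := by field_simp
  have h2 : 0 ≤ (m - n) * (m + q ^ 2 / (m - n) - (x ^ 2 * m + 2 * (x * y) * q + y ^ 2 * n)) := by
    have h3 : (m - n) * (m + q ^ 2 / (m - n) - (x ^ 2 * m + 2 * (x * y) * q + y ^ 2 * n)) =
        (x * q - y * (m - n)) ^ 2 + (y * q) ^ 2 := by
      linear_combination h1 - (q ^ 2 + m * (m - n)) * hxy
    rw [h3]; positivity
  linarith [nonneg_of_mul_nonneg_right h2 hg]

theorem IsOptimal.majorant_self (h : IsOptimal p β B θ) :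
    majorant p β B θ B (cos θ) (sin θ) (cos θ) (sin θ) = 1 + p := by
  have h1 := h.lin_pos
  have h2 := h.bil_pos
  simp only [majorant]; field_simp; ring

theorem IsOptimal.majorant_orthogonal_lt (h : IsOptimal p β B θ) :
    majorant p β B θ B (-sin θ) (cos θ) (-sin θ) (cos θ) <
      majorant p β B θ B (cos θ) (sin θ) (cos θ) (sin θ) := by
  rw [h.majorant_self]
  have := h.gap
  simpa only [majorant, ← pow_two] using this

theorem IsOptimal.eigenBound_self (h : IsOptimal p β B θ) : eigenBound p β B θ B = 1 + p := by
  have h0 : majorant p β B θ B (cos θ) (sin θ) (-sin θ) (cos θ) = 0 := h.crit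
  rw [eigenBound, h0, h.majorant_self]; simp

theorem IsOptimal.certificate (h : IsOptimal p β B θ) (φ : ℝ) :
    (1 - p) * (lin β B (cos φ) (sin φ) ^ 2 / lin β B (cos θ) (sin θ) ^ 2) +
      2 * p * (bil β B (cos φ) (sin φ) (cos φ) (sin φ) /
        bil β B (cos θ) (sin θ) (cos θ) (sin θ)) ≤ 1 + p := by
  have := majorant_le_eigenBound h.majorant_orthogonal_lt φ
  rw [h.eigenBound_self] at this
  simpa only [majorant, ← pow_two, mul_div_assoc] using this

/-- Apply log x ≤ x - 1 to the squared ratio of linear forms and to the ratio of quadratic forms. -/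
theorem pressureFn_le (hp : p ∈ Set.Icc (0 : ℝ) 1) (h : IsOptimal p β B θ) {B' φ : ℝ}
    (h1 : 0 < lin β B' (cos φ) (sin φ)) (h2 : 0 < bil β B' (cos φ) (sin φ) (cos φ) (sin φ)) :
    pressureFn p β B' φ ≤ pressureFn p β B θ +
      (majorant p β B θ B' (cos φ) (sin φ) (cos φ) (sin φ) - (1 + p)) / 2 := by
  have ha := h.lin_pos
  have hd := h.bil_pos
  simp only [pressureFn, majorant, ← pow_two, mul_div_assoc]
  set x := lin β B' (cos φ) (sin φ)
  set y := bil β B' (cos φ) (sin φ) (cos φ) (sin φ)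
  set a := lin β B (cos θ) (sin θ)
  set e := bil β B (cos θ) (sin θ) (cos θ) (sin θ)
  have l1 : 2 * (log x - log a) ≤ x ^ 2 / a ^ 2 - 1 := by
    have := log_le_sub_one_of_pos (show 0 < x ^ 2 / a ^ 2 by positivity)
    rw [log_div (by positivity) (by positivity), log_pow, log_pow] at this
    push_cast at this
    linarith
  have l2 : log y - log e ≤ y / e - 1 := by
    have := log_le_sub_one_of_pos (show 0 < y / e by positivity)
    rwa [log_div (by positivity) (by positivity)] at this
  have m1 := mul_le_mul_of_nonneg_left l1 (sub_nonneg.2 hp.2)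
  have m2 := mul_le_mul_of_nonneg_left l2 hp.1
  linarith

/-- u - l has a local minimum at x, so the two tangents coincide and f is trapped between two o(y -
x) errors. -/
theorem differentiableAt_of_squeeze {f l u : ℝ → ℝ} {x : ℝ} (hl : DifferentiableAt ℝ l x)
    (hu : DifferentiableAt ℝ u x) (hlf : ∀ᶠ y in 𝓝 x, l y ≤ f y) (hfu : ∀ᶠ y in 𝓝 x, f y ≤ u y)
    (hlx : l x = f x) (hux : u x = f x) : DifferentiableAt ℝ f x := by
  have hmin : IsLocalMin (fun y => u y - l y) x := by
    filter_upwards [hlf, hfu] with y h1 h2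
    rw [hlx, hux]; linarith
  have hd : deriv u x = deriv l x := by
    have h := hmin.deriv_eq_zero
    rw [deriv_fun_sub hu hl] at h; linarith
  have h1 := hl.hasDerivAt.isLittleO
  have h2 := hu.hasDerivAt.isLittleO
  rw [hd] at h2
  refine HasDerivAt.differentiableAt (f' := deriv l x) (HasDerivAt.of_isLittleO ?_)
  refine (Asymptotics.IsBigO.of_bound 1 ?_).trans_isLittleO (h1.norm_left.add h2.norm_left)
  filter_upwards [hlf, hfu] with y h3 h4
  simp only [norm_eq_abs, one_mul]
  rw [hlx, hux]
  refine le_trans ?_ (le_abs_self _)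
  rw [abs_le]
  constructor
  · have := neg_abs_le (l y - f x - (y - x) • deriv l x)
    have := abs_nonneg (u y - f x - (y - x) • deriv l x)
    linarith
  · have := le_abs_self (u y - f x - (y - x) • deriv l x)
    have := abs_nonneg (l y - f x - (y - x) • deriv l x)
    linarith

theorem differentiableAt_pressureFn (hp : p ∈ Set.Icc (0 : ℝ) 1) {Θ : ℝ → ℝ}
    (hΘ : ∀ B, IsOptimal p β B (Θ B)) (B : ℝ) :
    DifferentiableAt ℝ (fun b => pressureFn p β b (Θ b)) B := by
  have h := hΘ B
  have hlin : ∀ u v, Differentiable ℝ fun b => lin β b u v := by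
    intro u v; unfold lin; fun_prop
  have hbil : ∀ u v u' v', Differentiable ℝ fun b => bil β b u v u' v' := by
    intro u v u' v'; unfold bil; fun_prop
  have hmaj : ∀ u v u' v', Differentiable ℝ fun b => majorant p β B (Θ B) b u v u' v' := by
    intro u v u' v'; unfold majorant; fun_prop
  have hgap := sub_pos.2 h.majorant_orthogonal_lt
  refine differentiableAt_of_squeeze (l := fun b => pressureFn p β b (Θ B))
    (u := fun b => pressureFn p β B (Θ B) + (eigenBound p β B (Θ B) b - (1 + p)) / 2)
    ?_ ?_ ?_ ?_ rfl ?_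
  · unfold pressureFn
    exact (((hlin _ _ B).log h.lin_pos.ne').const_mul _).add
      (((hbil _ _ _ _ B).log h.bil_pos.ne').const_mul _)
  · unfold eigenBound
    refine (((((hmaj _ _ _ _ B).add (((hmaj _ _ _ _ B).pow 2).div
      ((hmaj _ _ _ _ B).sub (hmaj _ _ _ _ B)) hgap.ne'))).sub_const _).div_const _).const_add _
  -- Lower bound: the direction optimal at B is a competitor for b, compared through the majorant
  -- normalized at b.
  · filter_upwards [(hlin _ _).continuous.continuousAt.eventually_const_lt h.lin_pos,
      (hbil _ _ _ _).continuous.continuousAt.eventually_const_lt h.bil_pos] with b h1 h2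
    have h3 := pressureFn_le hp (hΘ b) h1 h2
    have h4 := majorant_le_eigenBound (hΘ b).majorant_orthogonal_lt (Θ B)
    rw [(hΘ b).eigenBound_self] at h4
    linarith
  -- Upper bound: the direction optimal at b is tested in the majorant normalized at B, whose gap
  -- persists for b near B.
  · filter_upwards [((hmaj _ _ _ _).sub (hmaj _ _ _ _)).continuous.continuousAt.eventually_const_lt
      hgap] with b hb
    have h3 := pressureFn_le hp h (hΘ b).lin_pos (hΘ b).bil_pos
    have h4 := majorant_le_eigenBound (sub_pos.1 hb) (Θ b)
    linarith
  · simp only [h.eigenBound_self]; ring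

end Optimizer

/-! ### Degree counts and the limit of the pressure -/

section Counting

variable {p : ℝ} {d : ∀ N : ℕ, Fin N → ℕ}

theorem IsCM12.prod_eq (hd : IsCM12 p d) (N : ℕ) (V : ℕ → ℝ) :
    ∏ i, V (d N i) = V 1 ^ (N - ⌊p * N⌋₊) * V 2 ^ ⌊p * N⌋₊ := by
  obtain ⟨h12, hcard⟩ := hd N
  have hc : (Finset.univ.filter fun i => ¬ d N i = 2).card = N - ⌊p * N⌋₊ := by
    have h := Finset.card_filter_add_card_filter_not (s := (Finset.univ : Finset (Fin N)))
      (fun i => d N i = 2)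
    rw [hcard, Finset.card_univ, Fintype.card_fin] at h
    omega
  rw [← Finset.prod_filter_mul_prod_filter_not Finset.univ (fun i => d N i = 2), mul_comm]
  congr 1
  · rw [← hc]
    refine Finset.prod_eq_pow_card fun i hi => ?_
    rw [(h12 i).resolve_right (Finset.mem_filter.1 hi).2]
  · rw [← hcard]
    refine Finset.prod_eq_pow_card fun i hi => ?_
    rw [(Finset.mem_filter.1 hi).2]

theorem IsCM12.sum_eq (hd : IsCM12 p d) (N : ℕ) :
    ∑ i, d N i = (N - ⌊p * N⌋₊) + 2 * ⌊p * N⌋₊ := by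
  -- The product formula at V k = exp k turns into the sum after taking logarithms.
  have h := hd.prod_eq N (fun k => exp k)
  rw [← exp_sum, ← exp_nat_mul, ← exp_nat_mul, ← exp_add] at h
  have h' := exp_injective h
  rw [← Nat.cast_sum] at h'
  rw [← Nat.cast_inj (R := ℝ), h']
  push_cast; ring

theorem IsCM12.even_iff (hd : IsCM12 p d) (N : ℕ) :
    Even (∑ i, d N i) ↔ Even (N - ⌊p * N⌋₊) := by
  rw [hd.sum_eq, Nat.even_add]; simp

theorem admissible_le_atTop : admissible d ≤ atTop := inf_le_left

theorem eventually_admissible : ∀ᶠ N in admissible d, Even (∑ i, d N i) :=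
  mem_inf_of_right (mem_principal_self _)

theorem IsCM12.graphExpect_partitionFn_eq (hd : IsCM12 p d) {N : ℕ} (hN : Even (∑ i, d N i))
    {β : ℝ} (hβ : 0 ≤ β) (B : ℝ) :
    graphExpect (d N) (partitionFn β B) =
      (∫ θ in -π..π, vertexWeight β B 1 θ ^ (N - ⌊p * N⌋₊) * vertexWeight β B 2 θ ^ ⌊p * N⌋₊) /
        ∫ θ in -π..π, cos θ ^ (N - ⌊p * N⌋₊) * (cos θ ^ 2) ^ ⌊p * N⌋₊ := by
  rw [graphExpect_partitionFn _ hN hβ]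
  congr 1
  · exact intervalIntegral.integral_congr fun θ _ => hd.prod_eq N fun k => vertexWeight β B k θ
  · refine intervalIntegral.integral_congr fun θ _ => ?_
    simp only [hd.sum_eq N, pow_add, pow_mul]

@[fun_prop]
theorem continuous_vertexWeight (β B : ℝ) (k : ℕ) : Continuous (vertexWeight β B k) := by
  unfold vertexWeight; fun_prop

theorem vertexWeight_two_nonneg (β B θ : ℝ) : 0 ≤ vertexWeight β B 2 θ := by
  unfold vertexWeight; positivity

theorem integral_cos_pos {n : ℕ} (hn : Even n) (m : ℕ) :
    0 < ∫ θ in -π..π, cos θ ^ n * (cos θ ^ 2) ^ m :=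
  integral_pow_mul_pow_pos (θ₀ := 0) continuous_cos (by fun_prop) (fun θ => sq_nonneg _)
    (by simp) (by simp) ⟨by simp [pi_pos], pi_pos⟩ hn m

theorem mem_Ioo_of_mem_Icc_half {θ : ℝ} (hθ : θ ∈ Set.Icc (-(π / 2)) (π / 2)) :
    θ ∈ Set.Ioo (-π) π := by
  have := pi_pos
  exact ⟨by linarith [hθ.1], by linarith [hθ.2]⟩

theorem IsCM12.graphExpect_pos (hp : p ∈ Set.Icc (0 : ℝ) 1) (hd : IsCM12 p d) {N : ℕ}
    (hN : Even (∑ i, d N i)) {β : ℝ} (hβ : 0 ≤ β) (B : ℝ) :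
    0 < graphExpect (d N) (partitionFn β B) := by
  obtain ⟨θ, hθ, ho⟩ := exists_isOptimal hp hβ B
  rw [hd.graphExpect_partitionFn_eq hN hβ]
  refine div_pos ?_ (integral_cos_pos ((hd.even_iff N).1 hN) _)
  exact integral_pow_mul_pow_pos (by fun_prop) (by fun_prop) (vertexWeight_two_nonneg β B)
    (by rw [vertexWeight_one]; exact ho.lin_pos) (by rw [vertexWeight_two]; exact ho.bil_pos)
    (mem_Ioo_of_mem_Icc_half hθ) ((hd.even_iff N).1 hN) _

theorem IsCM12.tendsto_annealedPressure (hp : p ∈ Set.Icc (0 : ℝ) 1) (hd : IsCM12 p d)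
    {β : ℝ} (hβ : 0 ≤ β) {B θ : ℝ} (hθ : θ ∈ Set.Icc (-(π / 2)) (π / 2))
    (ho : IsOptimal p β B θ) :
    Tendsto (fun N => annealedPressure (d N) β B) (admissible d) (𝓝 (pressureFn p β B θ)) := by
  have heven : ∀ᶠ N : ℕ in admissible d, Even (N - ⌊p * N⌋₊) :=
    eventually_admissible.mono fun N hN => (hd.even_iff N).1 hN
  have h1 := tendsto_log_integral_div (θ₀ := θ) hp (continuous_vertexWeight β B 1)
    (continuous_vertexWeight β B 2) (vertexWeight_two_nonneg β B)
    (by rw [vertexWeight_one]; exact ho.lin_pos) (by rw [vertexWeight_two]; exact ho.bil_pos)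
    (mem_Ioo_of_mem_Icc_half hθ)
    (by simp only [vertexWeight_one, vertexWeight_two]; exact ho.certificate)
    admissible_le_atTop heven
  -- The normalizing integral has maximum 1 at θ = 0 and contributes nothing to the limit.
  have h2 := tendsto_log_integral_div (A := cos) (D := fun θ => cos θ ^ 2) (θ₀ := 0) hp
    continuous_cos (by fun_prop) (fun θ => sq_nonneg _)
    (by simp) (by simp) ⟨by simp [pi_pos], pi_pos⟩
    (fun θ => by
      have := cos_sq_le_one θ
      have hp0 : 0 ≤ 1 + p := by linarith [hp.1]
      simp only [cos_zero, one_pow, div_one]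
      nlinarith)
    admissible_le_atTop heven
  have h3 := h1.sub h2
  simp only [vertexWeight_one, vertexWeight_two, cos_zero, one_pow, log_one, mul_zero, add_zero,
    sub_zero] at h3
  refine h3.congr' ?_
  filter_upwards [eventually_admissible] with N hN
  have hpos := integral_cos_pos ((hd.even_iff N).1 hN) ⌊p * N⌋₊
  have hZ := hd.graphExpect_pos hp hN hβ B
  have heq := hd.graphExpect_partitionFn_eq hN hβ B
  rw [heq] at hZ
  rw [annealedPressure, heq, log_div (by rintro h; simp [h] at hZ) hpos.ne', sub_div]
  simp only [vertexWeight_one, vertexWeight_two]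

end Counting

/-! ### Exponential tilting in finite volume -/

section Concentration

variable {N : ℕ} {d : Fin N → ℕ} {β B : ℝ}

theorem annealedMass_nonneg (σ : Spins N) : 0 ≤ annealedMass d β B σ := by
  have h : ∀ X : Equiv.Perm (HalfEdge d) → ℝ, (∀ τ, 0 ≤ X τ) → 0 ≤ graphExpect d X := fun X hX =>
    div_nonneg (Finset.sum_nonneg fun τ _ => hX τ) (Nat.cast_nonneg _)
  exact div_nonneg (h _ fun τ => (exp_pos _).le)
    (h _ fun τ => Finset.sum_nonneg fun σ _ => (exp_pos _).le)

theorem sum_graphExpect_boltzmann (b : ℝ) :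
    ∑ σ : Spins N, graphExpect d (fun τ => boltzmann β b τ σ) = graphExpect d (partitionFn β b) := by
  simp only [graphExpect, partitionFn, ← Finset.sum_div]
  rw [Finset.sum_comm]

theorem sum_annealedMass (hZ : 0 < graphExpect d (partitionFn β B)) :
    ∑ σ : Spins N, annealedMass d β B σ = 1 := by
  simp only [annealedMass, ← Finset.sum_div]
  rw [sum_graphExpect_boltzmann, div_self hZ.ne']

theorem sum_annealedMass_mul_exp (t : ℝ) :
    ∑ σ : Spins N, annealedMass d β B σ * exp (t * totalSpin σ) =
      graphExpect d (partitionFn β (B + t)) / graphExpect d (partitionFn β B) := by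
  rw [← sum_graphExpect_boltzmann (B + t), Finset.sum_div]
  refine Finset.sum_congr rfl fun σ _ => ?_
  rw [annealedMass, div_mul_eq_mul_div]
  congr 1
  simp only [graphExpect]
  rw [div_mul_eq_mul_div, Finset.sum_mul]
  congr 1
  refine Finset.sum_congr rfl fun τ _ => ?_
  rw [boltzmann, boltzmann, ← exp_add]
  congr 1; ring

/-- The exponential Chebyshev inequality for the total spin. -/
theorem annealedProb_le (hN : 0 < N) (hZ : ∀ b, 0 < graphExpect d (partitionFn β b))
    {A : Set (Spins N)} {t x : ℝ} (hA : ∀ σ ∈ A, t * x ≤ t * (totalSpin σ / N)) :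
    annealedProb d β B A ≤
      exp (N * (annealedPressure d β (B + t) - annealedPressure d β B - t * x)) := by
  have hN' : (0 : ℝ) < N := by exact_mod_cast hN
  have hle : annealedProb d β B A ≤ ∑ σ : Spins N,
      annealedMass d β B σ * exp (t * totalSpin σ) * exp (-(N * (t * x))) := by
    refine Finset.sum_le_sum fun σ _ => ?_
    have hm : 0 ≤ annealedMass d β B σ := annealedMass_nonneg σ
    by_cases hσ : σ ∈ A
    · rw [Set.indicator_of_mem hσ, mul_assoc, ← exp_add]
      refine le_mul_of_one_le_right hm (one_le_exp ?_)
      have h := mul_le_mul_of_nonneg_left (hA σ hσ) hN'.le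
      have h2 : (N : ℝ) * (t * (totalSpin σ / N)) = t * totalSpin σ := by field_simp
      linarith
    · rw [Set.indicator_of_notMem hσ]
      positivity
  refine hle.trans (le_of_eq ?_)
  rw [← Finset.sum_mul, sum_annealedMass_mul_exp, ← exp_log (hZ (B + t)), ← exp_log (hZ B),
    ← exp_sub, ← exp_add]
  congr 1
  simp only [annealedPressure]
  field_simp
  ring

theorem abs_totalSpin_div_le (σ : Spins N) : |totalSpin σ / N| ≤ 1 := by
  have h : |totalSpin σ| ≤ N := by
    refine (Finset.abs_sum_le_sum_abs _ _).trans (le_of_eq ?_)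
    have : ∀ i, |spin σ i| = 1 := fun i => by
      rcases spin_eq_one_or σ i with h | h <;> simp [h]
    simp [this]
  rw [abs_div, Nat.abs_cast]
  exact div_le_one_of_le₀ h (Nat.cast_nonneg _)

theorem annealedProb_union_le (A A' : Set (Spins N)) :
    annealedProb d β B (A ∪ A') ≤ annealedProb d β B A + annealedProb d β B A' := by
  rw [annealedProb, annealedProb, annealedProb, ← Finset.sum_add_distrib]
  refine Finset.sum_le_sum fun σ _ => ?_
  have := annealedMass_nonneg (d := d) (β := β) (B := B) σ
  by_cases h1 : σ ∈ A <;> by_cases h2 : σ ∈ A' <;> simp [h1, h2, this]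

theorem annealedProb_mono {A A' : Set (Spins N)} (h : A ⊆ A') :
    annealedProb d β B A ≤ annealedProb d β B A' :=
  Finset.sum_le_sum fun σ _ => Set.indicator_le_indicator_of_subset h annealedMass_nonneg σ

/-- The deviation is below ε off the event and at most 1 + |m| on it. -/
theorem abs_annealedMagnetization_sub_le (hZ : 0 < graphExpect d (partitionFn β B)) {m ε : ℝ}
    (hε : 0 < ε) :
    |annealedMagnetization d β B - m| ≤
      ε + (1 + |m|) * annealedProb d β B {σ | ε ≤ |totalSpin σ / N - m|} := by
  have h1 : annealedMagnetization d β B - m =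
      ∑ σ : Spins N, annealedMass d β B σ * (totalSpin σ / N - m) := by
    simp only [mul_sub, Finset.sum_sub_distrib, ← Finset.sum_mul, sum_annealedMass hZ, one_mul,
      annealedMagnetization]
  have h2 : ε = ∑ σ : Spins N, annealedMass d β B σ * ε := by
    rw [← Finset.sum_mul, sum_annealedMass hZ, one_mul]
  rw [h1]
  conv_rhs => rw [h2]
  rw [annealedProb, Finset.mul_sum, ← Finset.sum_add_distrib]
  refine (Finset.abs_sum_le_sum_abs _ _).trans (Finset.sum_le_sum fun σ _ => ?_)
  have hm : 0 ≤ annealedMass d β B σ := annealedMass_nonneg σ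
  rw [← h2, abs_mul, abs_of_nonneg hm]
  by_cases hσ : ε ≤ |totalSpin σ / N - m|
  · rw [Set.indicator_of_mem (by exact hσ)]
    have : |totalSpin σ / N - m| ≤ 1 + |m| :=
      (abs_sub _ _).trans (by linarith [abs_totalSpin_div_le σ])
    nlinarith [mul_le_mul_of_nonneg_left this hm, mul_nonneg hm hε.le]
  · rw [Set.indicator_of_notMem (by exact hσ)]
    push Not at hσ
    nlinarith [mul_le_mul_of_nonneg_left hσ.le hm]

end Concentration

/-! ### From a differentiable pressure to concentration -/

section Limits

variable {d : ∀ N : ℕ, Fin N → ℕ} {F : Filter ℕ} {β B m : ℝ} {ψ : ℝ → ℝ}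

theorem exists_rate (hF : F ≤ atTop)
    (hψ : ∀ b, Tendsto (fun N => annealedPressure (d N) β b) F (𝓝 (ψ b)))
    {t x : ℝ} (ht : ψ (B + t) - ψ B < t * x) :
    ∃ L > 0, ∀ᶠ N : ℕ in F,
      exp (N * (annealedPressure (d N) β (B + t) - annealedPressure (d N) β B - t * x)) ≤
        exp (-(N * L)) / 2 := by
  set η := t * x - (ψ (B + t) - ψ B) with hη
  have hη0 : 0 < η := sub_pos.2 ht
  -- The exponent per vertex is eventually below -η / 2. Half of this is the rate; the other half
  -- absorbs the factor 1 / 2 that lets two tails be added.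
  refine ⟨η / 4, by positivity, ?_⟩
  have hlim := ((hψ (B + t)).sub (hψ B)).sub_const (t * x)
  filter_upwards [hlim.eventually_lt_const (show _ < -(η / 2) by linarith),
    hF (eventually_ge_atTop ⌈4 * log 2 / η⌉₊)] with N h1 h2
  have h3 : 4 * log 2 / η ≤ N := (Nat.le_ceil _).trans (by exact_mod_cast h2)
  rw [div_le_iff₀ hη0] at h3
  have h4 : exp (-(N * (η / 4))) / 2 = exp (-(N * (η / 4)) - log 2) := by
    rw [exp_sub, exp_log two_pos]
  rw [h4]
  apply exp_le_exp.2
  have h5 := mul_le_mul_of_nonneg_left h1.le (Nat.cast_nonneg (α := ℝ) N)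
  linarith

/-- For small t the error of the linear approximation is at most ε|t| / 2; positive t serves the
upper tail, negative t the lower one. -/
theorem exists_slope_lt (hd : HasDerivAt ψ m B) {ε : ℝ} (hε : 0 < ε) :
    (∃ t > 0, ψ (B + t) - ψ B < t * (m + ε)) ∧ ∃ t < 0, ψ (B + t) - ψ B < t * (m - ε) := by
  have h := hasDerivAt_iff_isLittleO_nhds_zero.1 hd
  have h' := (Asymptotics.isLittleO_iff.1 h) (half_pos hε)
  obtain ⟨r, hr, hball⟩ := Metric.eventually_nhds_iff_ball.1 h'
  constructor
  · refine ⟨r / 2, by positivity, ?_⟩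
    have h1 := hball (r / 2) (by simp [abs_of_pos hr]; linarith)
    rw [norm_eq_abs, norm_eq_abs, abs_of_pos (half_pos hr), smul_eq_mul] at h1
    have h2 := (le_abs_self _).trans h1
    have : 0 < r / 2 * ε := by positivity
    linarith
  · refine ⟨-(r / 2), by linarith, ?_⟩
    have h1 := hball (-(r / 2)) (by simp [abs_of_pos hr]; linarith)
    rw [norm_eq_abs, norm_eq_abs, abs_neg, abs_of_pos (half_pos hr), smul_eq_mul] at h1
    have h2 := (le_abs_self _).trans h1
    have : 0 < r / 2 * ε := by positivity
    linarith

theorem exponential_concentration (hF : F ≤ atTop)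
    (hZ : ∀ᶠ N in F, ∀ b, 0 < graphExpect (d N) (partitionFn β b))
    (hψ : ∀ b, Tendsto (fun N => annealedPressure (d N) β b) F (𝓝 (ψ b)))
    (hm : HasDerivAt ψ m B) {ε : ℝ} (hε : 0 < ε) :
    ∃ L : ℝ, 0 < L ∧ ∀ᶠ N : ℕ in F,
      annealedProb (d N) β B {σ | ε ≤ |totalSpin σ / N - m|} ≤ exp (-(N * L)) := by
  obtain ⟨⟨t₁, ht₁, h₁⟩, ⟨t₂, ht₂, h₂⟩⟩ := exists_slope_lt hm hε
  obtain ⟨L₁, hL₁, hr₁⟩ := exists_rate hF hψ h₁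
  obtain ⟨L₂, hL₂, hr₂⟩ := exists_rate hF hψ h₂
  refine ⟨min L₁ L₂, lt_min hL₁ hL₂, ?_⟩
  filter_upwards [hZ, hr₁, hr₂, hF (eventually_gt_atTop 0)] with N hZN hN₁ hN₂ hN
  have hsub : {σ : Spins N | ε ≤ |totalSpin σ / N - m|} ⊆
      {σ | m + ε ≤ totalSpin σ / N} ∪ {σ | totalSpin σ / N ≤ m - ε} := by
    intro σ hσ
    rcases le_abs.1 (show ε ≤ |totalSpin σ / N - m| from hσ) with h | h
    · left; show m + ε ≤ _; linarith
    · right; show _ ≤ m - ε; linarith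
  refine (annealedProb_mono hsub).trans ((annealedProb_union_le _ _).trans ?_)
  have b₁ := (annealedProb_le (B := B) hN hZN (A := {σ | m + ε ≤ totalSpin σ / N}) (t := t₁)
    (fun σ hσ => mul_le_mul_of_nonneg_left hσ ht₁.le)).trans hN₁
  have b₂ := (annealedProb_le (B := B) hN hZN (A := {σ | totalSpin σ / N ≤ m - ε}) (t := t₂)
    (fun σ hσ => mul_le_mul_of_nonpos_left hσ ht₂.le)).trans hN₂
  have c₁ : exp (-(N * L₁)) ≤ exp (-(N * min L₁ L₂)) := by
    gcongr; exact min_le_left _ _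
  have c₂ : exp (-(N * L₂)) ≤ exp (-(N * min L₁ L₂)) := by
    gcongr; exact min_le_right _ _
  linarith

theorem tendsto_annealedMagnetization (hF : F ≤ atTop)
    (hZ : ∀ᶠ N in F, ∀ b, 0 < graphExpect (d N) (partitionFn β b))
    (hψ : ∀ b, Tendsto (fun N => annealedPressure (d N) β b) F (𝓝 (ψ b)))
    (hm : HasDerivAt ψ m B) :
    Tendsto (fun N => annealedMagnetization (d N) β B) F (𝓝 m) := by
  rw [Metric.tendsto_nhds]
  intro ε hε
  obtain ⟨L, hL, hprob⟩ := exponential_concentration hF hZ hψ hm (half_pos hε)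
  have hlim : Tendsto (fun N : ℕ => ε / 2 + (1 + |m|) * exp (-(N * L))) F
      (𝓝 (ε / 2 + (1 + |m|) * 0)) := by
    refine ((tendsto_exp_neg_atTop_nhds_zero.comp ?_).const_mul _).const_add _
    exact (tendsto_natCast_atTop_atTop.atTop_mul_const hL).mono_left hF
  filter_upwards [hZ, hprob, hlim.eventually_lt_const (show _ < ε by linarith)] with N h1 h2 h3
  rw [dist_eq]
  refine (abs_annealedMagnetization_sub_le (h1 B) (half_pos hε)).trans_lt (lt_of_le_of_lt ?_ h3)
  gcongr

end Limits

end AnnealedIsing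

theorem mainTheorem8 (p : ℝ) (hp : p ∈ Set.Icc (0 : ℝ) 1) :
    ∃ ψ M : ℝ → ℝ → ℝ,
      ∀ d : (∀ N : ℕ, Fin N → ℕ), AnnealedIsing.IsCM12 p d →
      ∀ β : ℝ, 0 ≤ β → ∀ B : ℝ,
        -- the limiting annealed magnetization `M β B` exists and is the `B`-derivative
        -- of the limiting annealed pressure
        Tendsto (fun N => AnnealedIsing.annealedPressure (d N) β B)
          (AnnealedIsing.admissible d) (𝓝 (ψ β B)) ∧
        Tendsto (fun N => AnnealedIsing.annealedMagnetization (d N) β B)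
          (AnnealedIsing.admissible d) (𝓝 (M β B)) ∧
        HasDerivAt (fun b => ψ β b) (M β B) B ∧
        -- exponential concentration of the total spin
        ∀ ε : ℝ, 0 < ε → ∃ L : ℝ, 0 < L ∧
          ∀ᶠ N : ℕ in AnnealedIsing.admissible d,
            AnnealedIsing.annealedProb (d N) β B
              {σ | ε ≤ |AnnealedIsing.totalSpin σ / N - M β B|} ≤ Real.exp (-(N * L)) := by
  have hex : ∀ β : ℝ, 0 ≤ β → ∃ Θ : ℝ → ℝ, ∀ B,
      Θ B ∈ Set.Icc (-(Real.pi / 2)) (Real.pi / 2) ∧ AnnealedIsing.IsOptimal p β B (Θ B) := by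
    intro β hβ
    choose Θ h1 h2 using AnnealedIsing.exists_isOptimal hp hβ
    exact ⟨Θ, fun B => ⟨h1 B, h2 B⟩⟩
  choose! Θ hΘ using hex
  -- Θ is chosen before the degree sequence, so both limits depend only on p, β and B.
  refine ⟨fun β B => AnnealedIsing.pressureFn p β B (Θ β B),
    fun β B => deriv (fun b => AnnealedIsing.pressureFn p β b (Θ β b)) B, ?_⟩
  intro d hd β hβ B
  have hψ := fun b => hd.tendsto_annealedPressure hp hβ (hΘ β hβ b).1 (hΘ β hβ b).2
  have hm := (AnnealedIsing.differentiableAt_pressureFn hp (fun b => (hΘ β hβ b).2) B).hasDerivAt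
  have hZ : ∀ᶠ N in AnnealedIsing.admissible d,
      ∀ b, 0 < AnnealedIsing.graphExpect (d N) (AnnealedIsing.partitionFn β b) :=
    AnnealedIsing.eventually_admissible.mono fun N hN => hd.graphExpect_pos hp hN hβ
  exact ⟨hψ B,
    AnnealedIsing.tendsto_annealedMagnetization AnnealedIsing.admissible_le_atTop hZ hψ hm, hm,
    fun ε hε => AnnealedIsing.exponential_concentration AnnealedIsing.admissible_le_atTop hZ hψ
      hm hε⟩
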